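/- Setting. Let $R$ be a commutative $\mathbb C$-algebra with commuting derivations $\partial_n=\partial/\partial t_n$, $n\ge 1$ (an algebra of functions of the times $t=(t_1,t_2,\dots)$, e.g. smooth functions or formal power series), and put $\partial_x=\partial_1$. For $f\in R$ the shift $t\pm[\lambda^{-1}]=(t_1\pm\lambda^{-1},\,t_2\pm\tfrac12\lambda^{-2},\dots)$ is understood through Taylor expansion, $$f(t\pm[\lambda^{-1}])=\exp\Big(\pm\sum_{k\ge1}\tfrac{1}{k\lambda^{k}}\partial_k\Big)f=\sum_{n\ge0}\lambda^{-n}p_n(\pm[\partial])f\in R[[\lambda^{-1}]],$$ where the Schur polynomials $p_n$ are defined by $\sum_n p_n(x)\lambda^{-n}=\exp\big(\sum_{k\ge1}x_k\lambda^{-k}\big)$ and $[x]=(x_1,x_2/2,x_3/3,\dots)$. Hirota's operators act by $P(D_1,D_2,\dots)\,a\cdot b=P(\partial_{t_1}-\partial_{t'_1},\partial_{t_2}-\partial_{t'_2},\dots)\,a(t)b(t')\big|_{t'=t}$, i.e. $D_j^m a\cdot b=\partial_s^m\,a(t_j+s)\,b(t_j-s)|_{s=0}$. The homogeneous $\widehat{sl}(2)$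 (AKNS) hierarchy. Let $q,r\in R$, $E=\tfrac{\lambda}{2}\sigma_3$, $A=q\sigma_++r\sigma_-$, $b_n=\tfrac{\lambda^n}{2}\sigma_3$. Let $\Theta=US$ be a dressing matrix: $U=e^{u}$, $S=e^{s}$, where $u$ and $s$ are $2\times2$ matrices over $\lambda^{-1}R[[\lambda^{-1}]]$, $u$ off-diagonal and $s$ traceless diagonal, such that $\Theta^{-1}(\partial_x+E+A)\Theta=\partial_x+E$, that is $\partial_x\Theta=\Theta E-(E+A)\Theta$, and $$\partial_n\Theta=(\Theta b_n\Theta^{-1})_-\,\Theta\qquad(n\ge1),$$ $(\cdot)_-$ being the part with negative powers of $\lambda$. Let $\mathrm{Tr}$ denote the coefficient of $\lambda^0$ in the matrix trace $\mathrm{tr}$, and set $$\mathcal J_n=\mathrm{Tr}\big((\lambda\tfrac{d}{d\lambda}\Theta)\,b_n\Theta^{-1}\big),\qquad \mathcal H_n=-\mathrm{Tr}\big(E\,\Theta b_n\Theta^{-1}\big).$$ Let $\tau$ be a tau-function of $\Theta$: an invertible element of $R$ with $\mathcal J_n=-\partial_n\log\tau$ for all $n\ge1$, where $\partial_n\log\tau=\tau^{-1}\partial_n\tau$.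 Theorem. Write $t_\pm=t\pm[\lambda^{-1}]$. Then: 1. The dressing matrix and its inverse are $$\Theta=\frac1{\tau(t)}\begin{pmatrix}\tau(t_+)&-\lambda^{-1}q(t_-)\tau(t_-)\\ \lambda^{-1}r(t_+)\tau(t_+)&\tau(t_-)\end{pmatrix},\qquad \Theta^{-1}=\frac1{\tau(t)}\begin{pmatrix}\tau(t_-)&\lambda^{-1}q(t_-)\tau(t_-)\\ -\lambda^{-1}r(t_+)\tau(t_+)&\tau(t_+)\end{pmatrix}.$$ 2. $\det\Theta=1$, that is $$1=\frac{\tau(t_+)\tau(t_-)}{\tau^2(t)}\Big(1+\frac{q(t_-)\,r(t_+)}{\lambda^2}\Big).$$ 3. In $R[[\lambda^{-1}]]$, $$\mathrm{tr}\big(\tfrac{\sigma_3}2\Theta\tfrac{\sigma_3}2\Theta^{-1}\big)=\frac{\tau(t_+)\tau(t_-)}{\tau^2(t)}-\frac12=-\sum_{n\ge1}\mathcal H_n\lambda^{-n-1}+\frac12,\qquad \mathcal H_n=-\partial_n\partial_x\log\tau .$$ 4. Consequently $$\frac{\tau(t_+)\tau(t_-)}{\tau^2(t)}=1+\sum_{n\ge1}\big(\partial_n\partial_x\log\tau\big)\lambda^{-n-1},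 \qquad(*)$$ and $\tau$ satisfies the Hirota bilinear equations $$\big(\tfrac12D_1D_n-p_{n+1}([D])\big)\,\tau\cdot\tau=0\qquad(n\ge1).\qquad(**)$$ Moreover, $(*)$ and $(**)$ are equivalent for every invertible $\tau\in R$. -/

import Mathlib

namespace AKNS

open scoped TensorProduct IsMulCommutative

noncomputable section

/-! Conventions.  `R` is a commutative `ℂ`-algebra of functions of the times `t = (t₁, t₂, …)`, and
`d n : Derivation ℂ R R` is `∂/∂t_n`; these derivations commute, and `∂_x = d 1`.
The power series variable `X` and the Laurent series variable stand for `z = λ⁻¹`; thus an element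
of grade `m` (a multiple of `λ ^ m`) sits in the coefficient of `z ^ (-m)`. -/

/-! ### Polynomials in commuting operators, Schur polynomials -/

/-- Substitution of a family of commuting operators into polynomials, `P ↦ P(T₁, T₂, …)`. -/
def evalCommuting {M : Type*} [AddCommGroup M] [Module ℂ M] (T : ℕ+ → Module.End ℂ M)
    (hT : ∀ i j, T i * T j = T j * T i) : MvPolynomial ℕ+ ℂ →ₐ[ℂ] Module.End ℂ M :=
  haveI : IsMulCommutative (Algebra.adjoin ℂ (Set.range T)) :=
    Algebra.isMulCommutative_adjoin ℂ (by
      rintro _ ⟨i, rfl⟩ _ ⟨j, rfl⟩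
      exact hT i j)
  (Algebra.adjoin ℂ (Set.range T)).val.comp
    (MvPolynomial.aeval fun k =>
      (⟨T k, Algebra.subset_adjoin ⟨k, rfl⟩⟩ : Algebra.adjoin ℂ (Set.range T)))

theorem evalCommuting_X {M : Type*} [AddCommGroup M] [Module ℂ M] (T : ℕ+ → Module.End ℂ M)
    (hT : ∀ i j, T i * T j = T j * T i) (k : ℕ+) :
    evalCommuting T hT (MvPolynomial.X k) = T k := by
  simp [evalCommuting]

/-- `ξ(x, λ⁻¹) = ∑_{k ≥ 1} x_k λ^{-k}`. -/
def xi : PowerSeries (MvPolynomial ℕ+ ℂ) :=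
  PowerSeries.mk fun k => if h : 0 < k then MvPolynomial.X (⟨k, h⟩ : ℕ+) else 0

/-- The Schur polynomials: `∑_n p_n(x) λ^{-n} = exp (∑_{k ≥ 1} x_k λ^{-k})`. -/
def schur (n : ℕ) : MvPolynomial ℕ+ ℂ :=
  PowerSeries.coeff n ((PowerSeries.exp (MvPolynomial ℕ+ ℂ)).subst xi)

/-- `P([x])` where `[x] = (x₁, x₂/2, x₃/3, …)`. -/
def bracket : MvPolynomial ℕ+ ℂ →ₐ[ℂ] MvPolynomial ℕ+ ℂ :=
  MvPolynomial.aeval fun k => ((k : ℕ) : ℂ)⁻¹ • MvPolynomial.X k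

/-- `P(ε x)` for a scalar `ε` (used for `ε = 1` and `ε = -1`). -/
def scaleVars (ε : ℂ) : MvPolynomial ℕ+ ℂ →ₐ[ℂ] MvPolynomial ℕ+ ℂ :=
  MvPolynomial.aeval fun k => ε • MvPolynomial.X k

variable {R : Type*} [CommRing R] [Algebra ℂ R]

/-! ### Shifted times and Hirota operators -/

theorem time_comm (d : ℕ+ → Derivation ℂ R R) (hd : ∀ m n f, d m (d n f) = d n (d m f))
    (i j : ℕ+) :
    ((d i : R →ₗ[ℂ] R) : Module.End ℂ R) * (d j : R →ₗ[ℂ] R)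
      = ((d j : R →ₗ[ℂ] R) : Module.End ℂ R) * (d i : R →ₗ[ℂ] R) := by
  ext f
  exact hd i j f

/-- The Taylor expansion in `λ⁻¹` of `f (t + ε [λ⁻¹])`, where
`[λ⁻¹] = (λ⁻¹, λ⁻²/2, λ⁻³/3, …)`:
`f (t + ε [λ⁻¹]) = exp (ε ∑_{k ≥ 1} λ^{-k} k⁻¹ ∂_k) f = ∑_n λ^{-n} p_n(ε [∂]) f`. -/
def shift (d : ℕ+ → Derivation ℂ R R) (hd : ∀ m n f, d m (d n f) = d n (d m f))
    (ε : ℂ) (f : R) : PowerSeries R :=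
  PowerSeries.mk fun n =>
    evalCommuting (fun k => ((d k : R →ₗ[ℂ] R) : Module.End ℂ R)) (time_comm d hd)
      (bracket (scaleVars ε (schur n))) f

/-- Hirota's operator `D_k`: on functions `a(t) b(t')` of two copies of the times it is
`∂/∂t_k - ∂/∂t'_k`. -/
def hirotaD (d : ℕ+ → Derivation ℂ R R) (k : ℕ+) : Module.End ℂ (R ⊗[ℂ] R) :=
  LinearMap.rTensor R (d k : R →ₗ[ℂ] R) - LinearMap.lTensor R (d k : R →ₗ[ℂ] R)

theorem hirotaD_comm (d : ℕ+ → Derivation ℂ R R) (hd : ∀ m n f, d m (d n f) = d n (d m f))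
    (i j : ℕ+) : hirotaD d i * hirotaD d j = hirotaD d j * hirotaD d i := by
  ext a b
  simp [hirotaD, hd i j]
  abel

/-- `P(D₁, D₂, …) a · b`: apply `P` in Hirota's operators to `a(t) b(t')`, then put `t' = t`.
By Taylor's formula, `P(D₁, D₂, …) a · b` is `P(∂/∂s₁, ∂/∂s₂, …) a(t + s) b(t - s)` at `s = 0`. -/
def hirota (d : ℕ+ → Derivation ℂ R R) (hd : ∀ m n f, d m (d n f) = d n (d m f))
    (P : MvPolynomial ℕ+ ℂ) (a b : R) : R :=
  LinearMap.mul' ℂ R (evalCommuting (hirotaD d) (hirotaD_comm d hd) P (a ⊗ₜ[ℂ] b))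

/-! ### Matrices over formal Laurent series in `λ⁻¹` -/

/-- `λ ^ m` as a Laurent series in `z = λ⁻¹`. -/
def lam (m : ℤ) : LaurentSeries R := HahnSeries.single (-m) 1

/-- Action of a linear map of `R` on the coefficients of a matrix of Laurent series. -/
def mapCoeff (D : R →ₗ[ℂ] R) (M : Matrix (Fin 2) (Fin 2) (LaurentSeries R)) :
    Matrix (Fin 2) (Fin 2) (LaurentSeries R) :=
  M.map fun f => f.map D

/-- `M_-`: the part of strictly negative grade. -/
def minusPart (M : Matrix (Fin 2) (Fin 2) (LaurentSeries R)) :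
    Matrix (Fin 2) (Fin 2) (LaurentSeries R) :=
  M.map fun f => f - HahnSeries.truncLT 1 f

/-- The grading operator of the homogeneous gradation on Laurent series, `Q = λ d/dλ`. -/
def gradeSeries (f : LaurentSeries R) : LaurentSeries R where
  coeff m := (-m) • f.coeff m
  isPWO_support' := f.isPWO_support.mono fun m hm h => hm (by
    simp only [h, smul_zero])

/-- `[Q, M]` for `Q = λ d/dλ`. -/
def grade (M : Matrix (Fin 2) (Fin 2) (LaurentSeries R)) :
    Matrix (Fin 2) (Fin 2) (LaurentSeries R) :=
  M.map gradeSeries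

/-- `Tr`: the matrix trace followed by the projection on grade zero. -/
def gradedTrace (M : Matrix (Fin 2) (Fin 2) (LaurentSeries R)) : R :=
  M.trace.coeff 0

/-- Power series in `λ⁻¹` as Laurent series. -/
def toLaurent (M : Matrix (Fin 2) (Fin 2) (PowerSeries R)) :
    Matrix (Fin 2) (Fin 2) (LaurentSeries R) :=
  M.map (HahnSeries.ofPowerSeries ℤ R)

/-- The constant matrix `σ₃ / 2`. -/
def halfSigma3 (R : Type*) [CommRing R] [Algebra ℂ R] : Matrix (Fin 2) (Fin 2) R :=
  !![algebraMap ℂ R (1 / 2), 0; 0, -algebraMap ℂ R (1 / 2)]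

/-- `b_n = E^{(n)} = λ^n σ₃ / 2`; in particular `E = b_1`. -/
def b (n : ℕ+) : Matrix (Fin 2) (Fin 2) (LaurentSeries R) :=
  (lam (n : ℤ) : LaurentSeries R) • (halfSigma3 R).map HahnSeries.C

/-- `A = q σ₊ + r σ₋`. -/
def potential (q r : R) : Matrix (Fin 2) (Fin 2) (LaurentSeries R) :=
  !![0, HahnSeries.C q; HahnSeries.C r, 0]

/-- The exponential of a matrix of power series in `λ⁻¹` without constant term: the terms
`M ^ m / m!` with `m > n` do not contribute to the coefficient of `λ^{-n}`. -/
def formalExp (M : Matrix (Fin 2) (Fin 2) (PowerSeries R)) :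
    Matrix (Fin 2) (Fin 2) (PowerSeries R) :=
  Matrix.of fun i j => PowerSeries.mk fun n =>
    ∑ m ∈ Finset.range (n + 1), ((m.factorial : ℂ)⁻¹) • PowerSeries.coeff n ((M ^ m) i j)

/-! ### The hierarchy and its tau-function -/

/-- `Θ` is a dressing matrix of the `sl(2)` AKNS hierarchy with Lax operator `L = ∂_x + E + A`,
`A = q σ₊ + r σ₋`:  `Θ = U S` with `U = exp u`, `S = exp s`, where `u` and `s` have negative grades
and take values in `M = Im (ad E)` (off-diagonal matrices) and in `K = Ker (ad E)` (traceless
diagonal matrices); `Θ⁻¹ L Θ = ∂_x + E`; and `Θ` evolves along the isospectral flows. -/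
structure IsDressing (d : ℕ+ → Derivation ℂ R R) (q r : R)
    (Θ : Matrix (Fin 2) (Fin 2) (PowerSeries R)) : Prop where
  factor : ∃ uPlus uMinus s : PowerSeries R,
    PowerSeries.constantCoeff uPlus = 0 ∧ PowerSeries.constantCoeff uMinus = 0 ∧
    PowerSeries.constantCoeff s = 0 ∧
    Θ = formalExp !![0, uPlus; uMinus, 0] * formalExp !![s, 0; 0, -s]
  lax : mapCoeff (d 1 : R →ₗ[ℂ] R) (toLaurent Θ)
    = toLaurent Θ * b 1 - (b 1 + potential q r) * toLaurent Θ
  flow : ∀ n : ℕ+, mapCoeff (d n : R →ₗ[ℂ] R) (toLaurent Θ)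
    = minusPart (toLaurent Θ * b n * (toLaurent Θ)⁻¹) * toLaurent Θ

/-- `𝒥_n = Tr ([Q, Θ] b_n Θ⁻¹)`. -/
def J (Θ : Matrix (Fin 2) (Fin 2) (PowerSeries R)) (n : ℕ+) : R :=
  gradedTrace (grade (toLaurent Θ) * b n * (toLaurent Θ)⁻¹)

/-- The Hamiltonian densities `ℋ_n = - Tr (E Θ b_n Θ⁻¹)`. -/
def H (Θ : Matrix (Fin 2) (Fin 2) (PowerSeries R)) (n : ℕ+) : R :=
  - gradedTrace (b 1 * toLaurent Θ * b n * (toLaurent Θ)⁻¹)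

/-- `Tr (½ σ₃ Θ ½ σ₃ Θ⁻¹)` as a power series in `λ⁻¹` (here without projection on a grade). -/
def sigmaTrace (Θ : Matrix (Fin 2) (Fin 2) (PowerSeries R)) : PowerSeries R :=
  ((halfSigma3 R).map PowerSeries.C * Θ * (halfSigma3 R).map PowerSeries.C * Θ⁻¹).trace

/-- `∂_n log τ = τ⁻¹ ∂_n τ` for an invertible function `τ`. -/
def dlog (d : ℕ+ → Derivation ℂ R R) (n : ℕ+) (τ : Rˣ) : R :=
  (↑τ⁻¹ : R) * d n (τ : R)

/-- `τ` is a tau-function of `Θ`: `𝒥_n = - ∂_n log τ` for all `n ≥ 1`. -/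
def IsTau (d : ℕ+ → Derivation ℂ R R) (Θ : Matrix (Fin 2) (Fin 2) (PowerSeries R)) (τ : Rˣ) :
    Prop :=
  ∀ n : ℕ+, J Θ n = - dlog d n τ

/-- The series `∑_{n ≥ 1} a_n λ^{-n-1}`. -/
def genSeries (a : ℕ+ → R) : PowerSeries R :=
  PowerSeries.mk fun m => if h : 0 < m - 1 then a ⟨m - 1, h⟩ else 0

/-- `τ(t + [λ⁻¹]) τ(t - [λ⁻¹]) / τ(t)²`. -/
def tauRatio (d : ℕ+ → Derivation ℂ R R) (hd : ∀ m n f, d m (d n f) = d n (d m f)) (τ : Rˣ) :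
    PowerSeries R :=
  PowerSeries.C ((↑τ⁻¹ : R) ^ 2) * shift d hd 1 τ * shift d hd (-1) τ

/-- The generating form of the Hirota equations,
`τ(t + [λ⁻¹]) τ(t - [λ⁻¹]) / τ(t)² = ∑_{n ≥ 1} (∂_n ∂_x log τ) λ^{-n-1} + 1`. -/
def HirotaGenerating (d : ℕ+ → Derivation ℂ R R) (hd : ∀ m n f, d m (d n f) = d n (d m f))
    (τ : Rˣ) : Prop :=
  tauRatio d hd τ = genSeries (fun n => d n (dlog d 1 τ)) + 1

/-- The Hirota bilinear equations `(½ D₁ D_n - p_{n+1}([D])) τ · τ = 0`, `n ≥ 1`. -/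
def HirotaBilinear (d : ℕ+ → Derivation ℂ R R) (hd : ∀ m n f, d m (d n f) = d n (d m f))
    (τ : Rˣ) : Prop :=
  ∀ n : ℕ+, hirota d hd
    ((1 / 2 : ℂ) • (MvPolynomial.X 1 * MvPolynomial.X n) - bracket (schur ((n : ℕ) + 1))) τ τ = 0

end

end AKNS

/-!
The idea is to characterise a shift of the times by a differential equation in `z = λ⁻¹`. Since
`f(t + ε [λ⁻¹]) = exp (ε ∑ z^k ∂_k / k) f`, the series `F = f(t + ε [λ⁻¹])` is the only solution of
`z dF/dz = ε ∑_{k ≥ 1} z^k ∂_k F` with `F(0) = f` (`eq_shift_of_timeDeriv`). On coefficients this is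
the recursion `IsExpSeq`, which holds for Schur polynomials in any commuting operators
(`isExpSeq_schur`) and is preserved by Cauchy products (`IsExpSeq.cauchy`). The latter gives both
the multiplicativity of the shift and `∑ₙ pₙ([D]) (a · b) λ^{-n} = a(t₊) b(t₋)`
(`hirota_bracket_schur`); hence the Hirota bilinear equations are the coefficients of the
generating form (`hirotaGenerating_iff_hirotaBilinear`).

It remains to see that `τ Θ` consists of shifts. Put `M = Θ (½ σ₃) Θ⁻¹`. The flows are
`∂_n Θ = (λⁿ M)_- Θ`, and summing them at the same value of `λ` gives
`∑_{n ≥ 1} zⁿ ∂_n Θ = (z dM/dz - M + ½ σ₃) Θ` (`timeSum_negPart`, `IsDressing.timeDeriv_eq`).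
The columns of `Θ` are eigenvectors of `M` for `± ½` and `det Θ = 1` (`det_formalExp`), so the
right-hand side simplifies to `± z dΘ_{ij}/dz + (∑ₙ 𝒥ₙ zⁿ) Θ_{ij}`, up to a multiple of `Θ_{ij}` off
the diagonal which division by `z` absorbs (`IsDressing.timeDeriv_entries`). As
`∂_n log τ = -𝒥ₙ`, multiplication by `τ` removes the term in the `𝒥ₙ`, and the entries of `τ Θ`
solve the equation of a shift (`tau_mul_diag`, `tau_mul_offDiag`). The initial values are `τ` on the
diagonal, and `-q τ` and `r τ` off it by the dressing equation (`IsDressing.coeff_one`).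

The remaining formulas follow from `det Θ = 1`, from `tr (½ σ₃ Θ ½ σ₃ Θ⁻¹) = Θ₀₀ Θ₁₁ - ½`, and from
`ℋ_n = ∂_n 𝒥₁`, which is the flow of the coefficient of `λ⁻¹` (`IsDressing.H_eq_dlog`).
-/

namespace AKNS

open PowerSeries Finset
open scoped TensorProduct

section Shift

/-! ### Exponential sequences of commuting operators -/

/-- The two ways of summing over triples `(i, j, k)` with `i + j + k = n`. -/
theorem sum_antidiagonal_assoc {N : Type*} [AddCommMonoid N] (f : ℕ → ℕ → ℕ → N) (n : ℕ) :
    ∑ p ∈ antidiagonal n, ∑ q ∈ antidiagonal p.1, f q.1 q.2 p.2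
      = ∑ p ∈ antidiagonal n, ∑ q ∈ antidiagonal p.2, f p.1 q.1 q.2 := by
  simp only [Finset.sum_sigma']
  apply Finset.sum_nbij' (fun ⟨⟨_i, j⟩, ⟨k, l⟩⟩ ↦ ⟨(k, l + j), (l, j)⟩)
    (fun ⟨⟨i, _j⟩, ⟨k, l⟩⟩ ↦ ⟨(i + k, l), (i, k)⟩) <;>
    rintro ⟨⟨a, b⟩, ⟨c, e⟩⟩ h <;>
    simp only [Finset.mem_sigma, HasAntidiagonal.mem_antidiagonal] at h ⊢ <;>
    grind

section ExpSeq

variable {M N P : Type*} [AddCommGroup M] [Module ℂ M] [AddCommGroup N] [Module ℂ N]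
  [AddCommGroup P] [Module ℂ P]

/-- `u` is the sequence of coefficients of a solution `F = ∑ uₙ zⁿ` of
`z dF/dz = ∑_{k ≥ 1} z^k T_k F`, the equation of `exp (∑_{k ≥ 1} z^k T_k / k) u₀`.
The operator written `T k` here is `T_{k+1}`. -/
def IsExpSeq (T : ℕ → Module.End ℂ M) (u : ℕ → M) : Prop :=
  ∀ n : ℕ, ((n : ℂ) + 1) • u (n + 1) = ∑ p ∈ antidiagonal n, T p.1 (u p.2)

/-- The recursion determines `u` from `u 0`, as `n + 1` is invertible in `ℂ`. -/
theorem IsExpSeq.unique {T : ℕ → Module.End ℂ M} {u v : ℕ → M} (hu : IsExpSeq T u)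
    (hv : IsExpSeq T v) (h0 : u 0 = v 0) (n : ℕ) : u n = v n := by
  induction n using Nat.strong_induction_on with
  | _ n ih =>
    rcases n with _ | n
    · exact h0
    · have hn : ((n : ℂ) + 1) ≠ 0 := Nat.cast_add_one_ne_zero n
      apply smul_right_injective M hn
      change ((n : ℂ) + 1) • u (n + 1) = ((n : ℂ) + 1) • v (n + 1)
      rw [hu n, hv n]
      refine Finset.sum_congr rfl fun p hp => ?_
      rw [ih p.2 (by have := mem_antidiagonal.1 hp; omega)]

/-- The Cauchy product of two solutions solves the equation of any operators which satisfy the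
Leibniz rule with respect to the product. -/
theorem IsExpSeq.cauchy {S : ℕ → Module.End ℂ M} {T : ℕ → Module.End ℂ N}
    {V : ℕ → Module.End ℂ P} {u : ℕ → M} {v : ℕ → N} (hu : IsExpSeq S u) (hv : IsExpSeq T v)
    (B : M →ₗ[ℂ] N →ₗ[ℂ] P) (hB : ∀ k x y, V k (B x y) = B (S k x) y + B x (T k y)) :
    IsExpSeq V fun n => ∑ p ∈ antidiagonal n, B (u p.1) (v p.2) := by
  intro n
  have h1 : ((n : ℂ) + 1) • ∑ p ∈ antidiagonal (n + 1), B (u p.1) (v p.2)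
      = ∑ p ∈ antidiagonal (n + 1), B ((p.1 : ℂ) • u p.1) (v p.2)
        + ∑ p ∈ antidiagonal (n + 1), B (u p.1) ((p.2 : ℂ) • v p.2) := by
    rw [Finset.smul_sum, ← Finset.sum_add_distrib]
    refine Finset.sum_congr rfl fun p hp => ?_
    have : ((n : ℂ) + 1) = p.1 + p.2 := by exact_mod_cast (mem_antidiagonal.1 hp).symm
    rw [this, add_smul]
    simp
  have h2 : ∑ p ∈ antidiagonal (n + 1), B ((p.1 : ℂ) • u p.1) (v p.2)
      = ∑ p ∈ antidiagonal n, ∑ q ∈ antidiagonal p.2, B (S p.1 (u q.1)) (v q.2) := by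
    rw [← sum_antidiagonal_assoc (fun i j k => B (S i (u j)) (v k)),
      Finset.Nat.sum_antidiagonal_succ]
    simp only [Nat.cast_zero, zero_smul, map_zero, LinearMap.zero_apply, zero_add]
    refine Finset.sum_congr rfl fun p _ => ?_
    rw [Nat.cast_add, Nat.cast_one, hu p.1]
    simp
  have h3 : ∑ p ∈ antidiagonal (n + 1), B (u p.1) ((p.2 : ℂ) • v p.2)
      = ∑ p ∈ antidiagonal n, ∑ q ∈ antidiagonal p.2, B (u q.1) (T p.1 (v q.2)) := by
    rw [← sum_antidiagonal_assoc (fun i j k => B (u j) (T i (v k))),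
      Finset.Nat.sum_antidiagonal_succ']
    simp only [Nat.cast_zero, zero_smul, map_zero, zero_add]
    have h4 : ∀ p : ℕ × ℕ, B (u p.1) (((p.2 + 1 : ℕ) : ℂ) • v (p.2 + 1))
        = ∑ q ∈ antidiagonal p.2, B (u p.1) (T q.1 (v q.2)) := by
      intro p
      rw [Nat.cast_add, Nat.cast_one, hv p.2]
      simp
    simp only [h4]
    rw [← sum_antidiagonal_assoc (fun i j k => B (u i) (T j (v k)))]
    refine Finset.sum_congr rfl fun p _ => ?_
    exact Finset.sum_bij' (fun q _ => q.swap) (fun q _ => q.swap) (by simp [add_comm])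
      (by simp [add_comm]) (by simp) (by simp) (by simp)
  rw [h1, h2, h3, ← Finset.sum_add_distrib]
  refine Finset.sum_congr rfl fun p _ => ?_
  rw [← Finset.sum_add_distrib, map_sum]
  simp [hB]

end ExpSeq

/-! ### Schur polynomials -/

theorem hasSubst_xi : HasSubst xi :=
  HasSubst.of_constantCoeff_zero' (by
    rw [← coeff_zero_eq_constantCoeff_apply]
    simp [xi])

theorem schur_zero : schur 0 = 1 := by
  rw [schur, coeff_subst' hasSubst_xi, finsum_eq_single _ 0]
  · simp
  · intro m hm
    simp [xi, hm]

/-- The coefficients of `(exp ξ)' = ξ' exp ξ`. -/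
theorem schur_succ (n : ℕ) :
    ((n : ℂ) + 1) • schur (n + 1)
      = ∑ p ∈ antidiagonal n,
        ((p.1 : ℂ) + 1) • (MvPolynomial.X p.1.succPNat * schur p.2) := by
  have h := derivative_subst (f := PowerSeries.exp (MvPolynomial ℕ+ ℂ)) hasSubst_xi
  rw [derivative_exp] at h
  have h' := congrArg (coeff n) h
  rw [coeff_derivative, mul_comm, mul_comm _ (d⁄dX _ xi), coeff_mul] at h'
  have key : ∀ (m : ℕ) (P : MvPolynomial ℕ+ ℂ),
      ((m : ℂ) + 1) • P = ((m : MvPolynomial ℕ+ ℂ) + 1) * P := by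
    intro m P
    rw [add_smul, Nat.cast_smul_eq_nsmul, one_smul, nsmul_eq_mul, add_mul, one_mul]
  rw [key]
  refine h'.trans (Finset.sum_congr rfl fun p _ => ?_)
  rw [coeff_derivative, key]
  simp only [xi, coeff_mk, Nat.succ_pos', dif_pos, schur]
  have : (⟨p.1 + 1, Nat.succ_pos'⟩ : ℕ+) = p.1.succPNat := rfl
  rw [this]
  ring

/-- If `φ` substitutes `T_k / k` for `x_k`, then `pₙ ↦ φ(pₙ) v` are the coefficients of
`exp (∑_{k ≥ 1} z^k T_k / k) v`. -/
theorem isExpSeq_schur {M : Type*} [AddCommGroup M] [Module ℂ M]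
    (φ : MvPolynomial ℕ+ ℂ →ₐ[ℂ] Module.End ℂ M) {T : ℕ → Module.End ℂ M}
    (hT : ∀ k : ℕ, ((k : ℂ) + 1) • φ (MvPolynomial.X k.succPNat) = T k) (v : M) :
    IsExpSeq T fun n => φ (schur n) v := by
  intro n
  have h := congrArg (fun P => φ P v) (schur_succ n)
  simp only [map_smul, map_sum, map_mul, LinearMap.smul_apply, LinearMap.sum_apply] at h
  rw [h]
  refine Finset.sum_congr rfl fun p _ => ?_
  rw [← hT]
  rfl

/-! ### Shifted times -/

variable {R : Type*} [CommRing R] [Algebra ℂ R] (d : ℕ+ → Derivation ℂ R R)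
  (hd : ∀ m n f, d m (d n f) = d n (d m f))

/-- The operators `ε ∂_{k+1}`, for which `IsExpSeq` is the equation of the shift by `ε [λ⁻¹]`. -/
noncomputable def shiftOp (ε : ℂ) (k : ℕ) : Module.End ℂ R := ε • (d k.succPNat : R →ₗ[ℂ] R)

theorem coeff_zero_shift (ε : ℂ) (f : R) : coeff 0 (shift d hd ε f) = f := by
  simp [shift, schur_zero]

theorem isExpSeq_shift (ε : ℂ) (f : R) :
    IsExpSeq (shiftOp d ε) fun n => coeff n (shift d hd ε f) := by
  simp only [shift, coeff_mk]
  refine isExpSeq_schur (((evalCommuting _ (time_comm d hd)).comp bracket).comp (scaleVars ε))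
    (fun k => ?_) f
  simp only [AlgHom.comp_apply, scaleVars, bracket, MvPolynomial.aeval_X, map_smul,
    evalCommuting_X, shiftOp, smul_smul]
  congr 1
  have : ((k : ℂ) + 1) ≠ 0 := Nat.cast_add_one_ne_zero k
  simp
  field_simp

theorem coeff_one_shift (ε : ℂ) (f : R) : coeff 1 (shift d hd ε f) = ε • d 1 f := by
  have h := isExpSeq_shift d hd ε f 0
  simp only [Nat.antidiagonal_zero, Finset.sum_singleton, coeff_zero_shift] at h
  have h' : coeff 1 (shift d hd ε f) = shiftOp d ε 0 f := by simpa using h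
  exact h'

theorem eq_shift_of_isExpSeq {ε : ℂ} {F : PowerSeries R}
    (hF : IsExpSeq (shiftOp d ε) fun n => coeff n F) : F = shift d hd ε (coeff 0 F) :=
  PowerSeries.ext fun n => hF.unique (isExpSeq_shift d hd ε _) (coeff_zero_shift d hd ε _).symm n

/-- Both sides solve the equation of the shift with initial value `f g`, as `∂_k` satisfies the
Leibniz rule. -/
theorem shift_mul (ε : ℂ) (f g : R) :
    shift d hd ε (f * g) = shift d hd ε f * shift d hd ε g := by
  have h := eq_shift_of_isExpSeq d hd (ε := ε) (F := shift d hd ε f * shift d hd ε g) (by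
    simp only [coeff_mul]
    refine (isExpSeq_shift d hd ε f).cauchy (isExpSeq_shift d hd ε g) (LinearMap.mul ℂ R)
      fun k x y => ?_
    simp [shiftOp, mul_comm]
    ring)
  rw [h]
  simp [coeff_mul, coeff_zero_shift]

/-! ### Hirota operators -/

/-- `∑ₙ pₙ([D]) (a · b) λ^{-n} = a(t + [λ⁻¹]) b(t - [λ⁻¹])`: before putting `t' = t`, both sides
solve the equation of the operators `D_k` with initial value `a ⊗ b`. -/
theorem hirota_bracket_schur (n : ℕ) (a b : R) :
    hirota d hd (bracket (schur n)) a b = coeff n (shift d hd 1 a * shift d hd (-1) b) := by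
  have h1 := isExpSeq_schur ((evalCommuting _ (hirotaD_comm d hd)).comp bracket)
    (T := fun k => hirotaD d k.succPNat) (fun k => by
      simp only [AlgHom.comp_apply, bracket, MvPolynomial.aeval_X, map_smul,
        evalCommuting_X, smul_smul]
      have : ((k : ℂ) + 1) ≠ 0 := Nat.cast_add_one_ne_zero k
      simp [this]) (a ⊗ₜ[ℂ] b)
  have h2 := (isExpSeq_shift d hd 1 a).cauchy (isExpSeq_shift d hd (-1) b)
    (TensorProduct.mk ℂ R R) (V := fun k => hirotaD d k.succPNat) (fun k x y => by
      simp [shiftOp, hirotaD, TensorProduct.tmul_neg, sub_eq_add_neg])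
  have h3 := h1.unique h2 (by simp [schur_zero, coeff_zero_shift]) n
  rw [hirota, coeff_mul]
  have h4 := congrArg (LinearMap.mul' ℂ R) h3
  simpa using h4

theorem hirota_X_mul_X (m n : ℕ+) (a b : R) :
    hirota d hd (MvPolynomial.X m * MvPolynomial.X n) a b
      = d m (d n a) * b - d m a * d n b - d n a * d m b + a * d m (d n b) := by
  simp [hirota, evalCommuting_X, hirotaD]
  ring

/-- `τ² ∂_n ∂_m log τ = τ ∂_n ∂_m τ - ∂_n τ ∂_m τ`. -/
theorem dlog_deriv (m n : ℕ+) (τ : Rˣ) :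
    (τ : R) ^ 2 * d n (dlog d m τ) = τ * d n (d m τ) - d n τ * d m τ := by
  have h0 : d n ((↑τ⁻¹ : R) * τ) = 0 := by simp
  rw [Derivation.leibniz] at h0
  simp only [smul_eq_mul] at h0
  rw [dlog, Derivation.leibniz]
  simp only [smul_eq_mul]
  linear_combination ((τ : R) * d n (d m τ) - d n τ * d m τ) * τ.mul_inv + τ * d m τ * h0

/-- The generating form and the bilinear form of the Hirota equations agree: the coefficients of
`1` and of `λ⁻¹` of the generating form hold for every `ρ`, and that of `λ^{-n-1}` is the
`n`-th bilinear equation divided by `ρ²`. -/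
theorem hirotaGenerating_iff_hirotaBilinear (ρ : Rˣ) :
    HirotaGenerating d hd ρ ↔ HirotaBilinear d hd ρ := by
  have hinv : (↑ρ⁻¹ : R) * ρ = 1 := ρ.inv_mul
  have hcoeff (n : ℕ+) : coeff ((n : ℕ) + 1) (tauRatio d hd ρ)
      = (↑ρ⁻¹ : R) ^ 2 * coeff ((n : ℕ) + 1) (shift d hd 1 ρ * shift d hd (-1) ρ) := by
    rw [tauRatio, mul_assoc, coeff_C_mul]
  have hgen (n : ℕ+) : coeff ((n : ℕ) + 1) (genSeries (fun n => d n (dlog d 1 ρ)) + 1)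
      = d n (dlog d 1 ρ) := by
    simp [genSeries, coeff_one]
    rfl
  have hbil (n : ℕ+) : hirota d hd ((1 / 2 : ℂ) • (MvPolynomial.X 1 * MvPolynomial.X n)
        - bracket (schur ((n : ℕ) + 1))) ρ ρ
      = (ρ : R) ^ 2 * d n (dlog d 1 ρ)
        - coeff ((n : ℕ) + 1) (shift d hd 1 ρ * shift d hd (-1) ρ) := by
    -- `½ D₁ D_n ρ · ρ = ρ ∂₁ ∂_n ρ - ∂₁ ρ ∂_n ρ = ρ² ∂_n ∂₁ log ρ`
    have hlin (P Q : MvPolynomial ℕ+ ℂ) : hirota d hd ((1 / 2 : ℂ) • P - Q) ρ ρ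
        = (1 / 2 : ℂ) • hirota d hd P ρ ρ - hirota d hd Q ρ ρ := by
      simp [hirota]
    rw [hlin, hirota_bracket_schur, hirota_X_mul_X, dlog_deriv, hd 1 n]
    congr 1
    rw [show d n (d 1 (ρ : R)) * ρ - d 1 ρ * d n ρ - d n ρ * d 1 ρ + ρ * d n (d 1 ρ)
      = (2 : ℂ) • ((ρ : R) * d n (d 1 ρ) - d n ρ * d 1 ρ) by rw [two_smul]; ring, smul_smul]
    norm_num
  constructor
  · intro h n
    have hn := congrArg (coeff ((n : ℕ) + 1)) h
    rw [hcoeff, hgen] at hn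
    rw [hbil, ← hn]
    linear_combination (coeff ((n : ℕ) + 1) (shift d hd 1 ρ * shift d hd (-1) ρ))
      * (↑ρ⁻¹ * ρ + 1) * hinv
  · intro h
    ext m
    match m with
    | 0 =>
      have : (↑ρ⁻¹ : R) ^ 2 * ρ * ρ = 1 := by
        linear_combination (↑ρ⁻¹ * ρ + 1) * hinv
      rw [tauRatio, mul_assoc, coeff_C_mul]
      simp [coeff_mul, coeff_zero_shift, genSeries, ← mul_assoc, this]
    | 1 =>
      rw [tauRatio, mul_assoc, coeff_C_mul]
      simp [coeff_mul, coeff_zero_shift, coeff_one_shift, genSeries, coeff_one,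
        Finset.Nat.antidiagonal_succ]
      ring
    | m + 2 =>
      have hn := h m.succPNat
      rw [hbil, sub_eq_zero] at hn
      have h1 := hcoeff m.succPNat
      have h2 := hgen m.succPNat
      rw [← hn] at h1
      simp only [Nat.succPNat_coe] at h1 h2
      rw [h1, h2]
      linear_combination (d m.succPNat (dlog d 1 ρ)) * (↑ρ⁻¹ * ρ + 1) * hinv

end Shift

section FormalExp

variable {R : Type*} [CommRing R] [Algebra ℂ R]

/-! ### Formal exponentials of matrices -/

/-- The truncation below degree `K` of the exponential series of `ε x`. -/
noncomputable def expTrunc (ε : ℂ) (K : ℕ) : Polynomial ℂ :=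
  ∑ m ∈ range K, Polynomial.monomial m (ε ^ m * (m.factorial : ℂ)⁻¹)

theorem coeff_expTrunc {ε : ℂ} {K n : ℕ} (h : n < K) :
    (expTrunc ε K).coeff n = ε ^ n * (n.factorial : ℂ)⁻¹ := by
  simp [expTrunc, Polynomial.coeff_monomial, h]

theorem X_pow_dvd_expTrunc_mul_sub_one (K : ℕ) :
    (Polynomial.X : Polynomial ℂ) ^ K ∣ expTrunc 1 K * expTrunc (-1) K - 1 := by
  rw [Polynomial.X_pow_dvd_iff]
  intro n hn
  have h := congrArg (coeff n) (exp_mul_exp_neg_eq_one (A := ℂ))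
  rw [evalNegHom, coeff_mul] at h
  rw [Polynomial.coeff_sub, Polynomial.coeff_mul, sub_eq_zero]
  refine (Finset.sum_congr rfl fun p hp => ?_).trans (h.trans ?_)
  · have := mem_antidiagonal.1 hp
    rw [coeff_expTrunc (by omega), coeff_expTrunc (by omega), coeff_rescale]
    simp
  · rw [coeff_one, Polynomial.coeff_one]

theorem aeval_expTrunc (M : Matrix (Fin 2) (Fin 2) (PowerSeries R)) (ε : ℂ) (K : ℕ) :
    Polynomial.aeval M (expTrunc ε K)
      = ∑ m ∈ range K, (ε ^ m * (m.factorial : ℂ)⁻¹) • M ^ m := by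
  simp only [expTrunc, map_sum, Polynomial.aeval_monomial, ← Algebra.smul_def]

/-- `M` has no constant term, so that `M ^ m` is divisible by `z ^ m`. -/
theorem X_pow_dvd_pow_apply {R : Type*} [CommRing R] {M : Matrix (Fin 2) (Fin 2) (PowerSeries R)}
    (hM : ∀ i j, constantCoeff (M i j) = 0) (m : ℕ) (i j : Fin 2) :
    (X : PowerSeries R) ^ m ∣ (M ^ m) i j := by
  have h : ∀ i j, ∃ c, M i j = X * c := fun i j => X_dvd_iff.2 (hM i j)
  choose N hN using h
  have : M = (X : PowerSeries R) • Matrix.of N := by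
    ext1 i j
    simp [hN i j]
  rw [this, smul_pow, Matrix.smul_apply, smul_eq_mul]
  exact dvd_mul_right _ _

theorem X_pow_dvd_formalExp_sub {M : Matrix (Fin 2) (Fin 2) (PowerSeries R)}
    (hM : ∀ i j, constantCoeff (M i j) = 0) (K : ℕ) (i j : Fin 2) :
    (X : PowerSeries R) ^ K ∣ formalExp M i j - Polynomial.aeval M (expTrunc 1 K) i j := by
  rw [X_pow_dvd_iff]
  intro n hn
  rw [map_sub, sub_eq_zero, aeval_expTrunc, Matrix.sum_apply, map_sum, formalExp, Matrix.of_apply,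
    coeff_mk]
  simp only [one_pow, one_mul, Matrix.smul_apply, coeff_smul]
  refine Finset.sum_subset (Finset.range_subset_range.2 hn) fun m _ hm => ?_
  have hm' : n < m := by simpa using hm
  rw [X_pow_dvd_iff.1 (X_pow_dvd_pow_apply hM m i j) n hm', smul_zero]

/-- A traceless `2 × 2` matrix satisfies `adj M = -M`, hence `adj (exp M) = exp (-M)` and
`det (exp M) = exp M · exp (-M) = 1`. The argument is carried out modulo every power of `z`, on
truncations of the exponential. -/
theorem det_formalExp {M : Matrix (Fin 2) (Fin 2) (PowerSeries R)}
    (hM : ∀ i j, constantCoeff (M i j) = 0) (htr : M 0 0 + M 1 1 = 0) :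
    (formalExp M).det = 1 := by
  have hadj : M.adjugate = -M := by
    rw [Matrix.adjugate_fin_two]
    ext1 i j
    fin_cases i <;> fin_cases j <;> simp
    · linear_combination htr
    · linear_combination htr
  have hadj' (K : ℕ) : (Polynomial.aeval M (expTrunc 1 K)).adjugate
      = Polynomial.aeval M (expTrunc (-1) K) := by
    -- on `2 × 2` matrices the adjugate is linear
    have hlin : ∀ A : Matrix (Fin 2) (Fin 2) (PowerSeries R),
        A.adjugate = (Matrix.trace A) • (1 : Matrix (Fin 2) (Fin 2) (PowerSeries R)) - A := by
      intro A
      rw [Matrix.adjugate_fin_two, Matrix.trace_fin_two]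
      ext1 i j
      fin_cases i <;> fin_cases j <;> simp
    have hpow (m : ℕ) :
        Matrix.trace (M ^ m) • (1 : Matrix (Fin 2) (Fin 2) (PowerSeries R)) - M ^ m
          = (-1 : ℂ) ^ m • M ^ m := by
      rw [← hlin, Matrix.adjugate_pow, hadj]
      rcases Nat.even_or_odd m with hm | hm <;> simp [hm.neg_one_pow, hm.neg_pow]
    rw [hlin, aeval_expTrunc, aeval_expTrunc, Matrix.trace_sum, Finset.sum_smul,
      ← Finset.sum_sub_distrib]
    refine Finset.sum_congr rfl fun m _ => ?_
    rw [Matrix.trace_smul, smul_assoc, ← smul_sub, hpow, smul_smul, one_pow, one_mul, mul_comm]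
  have hdvd (K : ℕ) : (X : PowerSeries R) ^ K ∣ (formalExp M).det - 1 := by
    obtain ⟨Q, hQ⟩ := X_pow_dvd_expTrunc_mul_sub_one K
    have h1 : (Polynomial.aeval M (expTrunc 1 K)).det - 1
        = (M ^ K * Polynomial.aeval M Q) 0 0 := by
      have h2 := congrArg (fun p => Polynomial.aeval M p 0 0) hQ
      simp only [map_sub, map_mul, ← hadj', Matrix.mul_adjugate, map_one, map_pow,
        Polynomial.aeval_X] at h2
      simpa using h2
    have h3 : (X : PowerSeries R) ^ K ∣ (Polynomial.aeval M (expTrunc 1 K)).det - 1 := by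
      rw [h1, Matrix.mul_apply]
      exact Finset.dvd_sum fun k _ => (X_pow_dvd_pow_apply hM K 0 k).mul_right _
    have h4 := X_pow_dvd_formalExp_sub hM K
    obtain ⟨c, hc⟩ := h3
    choose e he using h4
    rw [Matrix.det_fin_two] at hc ⊢
    refine ⟨c + e 0 0 * formalExp M 1 1 + (Polynomial.aeval M (expTrunc 1 K)) 0 0 * e 1 1
      - e 0 1 * formalExp M 1 0 - (Polynomial.aeval M (expTrunc 1 K)) 0 1 * e 1 0, ?_⟩
    linear_combination hc + formalExp M 1 1 * he 0 0
      + (Polynomial.aeval M (expTrunc 1 K)) 0 0 * he 1 1 - formalExp M 1 0 * he 0 1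
      - (Polynomial.aeval M (expTrunc 1 K)) 0 1 * he 1 0
  rw [← sub_eq_zero]
  ext n
  exact X_pow_dvd_iff.1 (hdvd (n + 1)) n n.lt_succ_self

theorem constantCoeff_formalExp (M : Matrix (Fin 2) (Fin 2) (PowerSeries R)) (i j : Fin 2) :
    constantCoeff (formalExp M i j) = (1 : Matrix (Fin 2) (Fin 2) R) i j := by
  rw [← coeff_zero_eq_constantCoeff_apply, formalExp, Matrix.of_apply, coeff_mk]
  by_cases h : i = j <;> simp [Matrix.one_apply, h]

section Factor

variable {d : ℕ+ → Derivation ℂ R R} {q r : R} {Θ : Matrix (Fin 2) (Fin 2) (PowerSeries R)}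

theorem IsDressing.det_eq_one (hΘ : IsDressing d q r Θ) : Θ.det = 1 := by
  obtain ⟨u, v, s, hu, hv, hs, rfl⟩ := hΘ.factor
  rw [Matrix.det_mul, det_formalExp, det_formalExp, one_mul]
  · simp [Fin.forall_fin_two, hs]
  · simp
  · simp [Fin.forall_fin_two, hu, hv]
  · simp

theorem IsDressing.constantCoeff_apply (hΘ : IsDressing d q r Θ) (i j : Fin 2) :
    constantCoeff (Θ i j) = (1 : Matrix (Fin 2) (Fin 2) R) i j := by
  obtain ⟨u, v, s, hu, hv, hs, rfl⟩ := hΘ.factor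
  rw [Matrix.mul_apply, map_sum]
  simp only [map_mul, constantCoeff_formalExp]
  rw [← Matrix.mul_apply, one_mul]

end Factor

end FormalExp

section Laurent

variable {R : Type*} [CommRing R]

/-! ### From Laurent series to power series -/

/-- `(λⁿ f)_-`, a power series in `λ⁻¹`. -/
noncomputable def negPart (n : ℕ) (f : PowerSeries R) : PowerSeries R :=
  PowerSeries.mk fun k => if k = 0 then 0 else coeff (k + n) f

theorem toLaurent_mul (A B : Matrix (Fin 2) (Fin 2) (PowerSeries R)) :
    toLaurent (A * B) = toLaurent A * toLaurent B :=
  Matrix.map_mul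

theorem toLaurent_injective :
    Function.Injective (toLaurent : Matrix (Fin 2) (Fin 2) (PowerSeries R) → _) := by
  intro A B h
  ext1 i j
  exact HahnSeries.ofPowerSeries_injective (congrFun (congrFun h i) j)

theorem toLaurent_inv {A : Matrix (Fin 2) (Fin 2) (PowerSeries R)} (hA : A.det = 1) :
    (toLaurent A)⁻¹ = toLaurent A⁻¹ := by
  apply Matrix.inv_eq_right_inv
  rw [← toLaurent_mul, Matrix.mul_nonsing_inv _ (by simp [hA])]
  exact Matrix.map_one _ (map_zero _) (map_one _)

theorem coeff_lam_mul (n : ℕ) (f : LaurentSeries R) (m : ℤ) :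
    (lam (n : ℤ) * f).coeff m = f.coeff (m + n) := by
  have h := HahnSeries.coeff_single_mul_add (r := (1 : R)) (x := f) (a := m + n) (b := -(n : ℤ))
  rw [one_mul, add_neg_cancel_right] at h
  exact h

theorem coeff_ofPowerSeries_natCast (f : PowerSeries R) (n : ℕ) :
    (HahnSeries.ofPowerSeries ℤ R f).coeff (n : ℤ) = coeff n f :=
  HahnSeries.ofPowerSeries_apply_coeff f n

theorem coeff_ofPowerSeries_neg (f : PowerSeries R) {m : ℤ} (hm : m < 0) :
    (HahnSeries.ofPowerSeries ℤ R f).coeff m = 0 := by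
  have := PowerSeries.coeff_coe f m
  rwa [if_pos hm] at this

theorem minusPart_lam_smul (n : ℕ) (A : Matrix (Fin 2) (Fin 2) (PowerSeries R)) :
    minusPart ((lam (n : ℤ) : LaurentSeries R) • toLaurent A) = toLaurent (A.map (negPart n)) := by
  ext i j m
  simp only [minusPart, toLaurent, Matrix.map_apply, Matrix.smul_apply, smul_eq_mul,
    HahnSeries.coeff_sub, HahnSeries.coeff_truncLT, coeff_lam_mul]
  rcases lt_or_ge m 0 with hm | hm
  · rw [coeff_ofPowerSeries_neg (negPart n (A i j)) hm, if_pos (by omega), sub_self]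
  · lift m to ℕ using hm
    rw [coeff_ofPowerSeries_natCast (negPart n (A i j)), ← Nat.cast_add,
      coeff_ofPowerSeries_natCast, negPart, coeff_mk]
    rcases m with _ | m
    · simp
    · rw [if_neg (by push_cast; omega), if_neg (by omega), sub_zero]

theorem grade_toLaurent (A : Matrix (Fin 2) (Fin 2) (PowerSeries R)) :
    grade (toLaurent A) = toLaurent (A.map fun f => -(X * d⁄dX R f)) := by
  ext i j m
  simp only [grade, toLaurent, Matrix.map_apply, gradeSeries]
  rcases lt_or_ge m 0 with hm | hm
  · rw [coeff_ofPowerSeries_neg _ hm, coeff_ofPowerSeries_neg _ hm, smul_zero]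
  · lift m to ℕ using hm
    rw [coeff_ofPowerSeries_natCast, coeff_ofPowerSeries_natCast]
    rcases m with _ | m
    · simp
    · rw [map_neg, coeff_succ_X_mul, coeff_derivative, neg_smul, natCast_zsmul, nsmul_eq_mul]
      push_cast
      ring

theorem gradedTrace_lam_smul (n : ℕ) (A : Matrix (Fin 2) (Fin 2) (PowerSeries R)) :
    gradedTrace ((lam (n : ℤ) : LaurentSeries R) • toLaurent A) = coeff n A.trace := by
  rw [gradedTrace, Matrix.trace_smul, smul_eq_mul, coeff_lam_mul, zero_add,
    ← coeff_ofPowerSeries_natCast]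
  simp [toLaurent, Matrix.trace_fin_two]

theorem inv_eq_of_det_eq_one {A : Matrix (Fin 2) (Fin 2) (PowerSeries R)} (hA : A.det = 1) :
    A⁻¹ = !![A 1 1, -A 0 1; -A 1 0, A 0 0] := by
  rw [Matrix.inv_def, hA, Ring.inverse_one, one_smul, Matrix.adjugate_fin_two]

variable [Algebra ℂ R]

/-- `D` applied to each coefficient of a power series. -/
noncomputable def mapDeriv (D : R →ₗ[ℂ] R) (f : PowerSeries R) : PowerSeries R :=
  PowerSeries.mk fun k => D (coeff k f)

/-- `σ₃ / 2` as a matrix of power series. -/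
noncomputable def sigmaSeries (R : Type*) [CommRing R] [Algebra ℂ R] :
    Matrix (Fin 2) (Fin 2) (PowerSeries R) :=
  (halfSigma3 R).map PowerSeries.C

theorem sigmaSeries_eq : sigmaSeries R
    = !![C (algebraMap ℂ R (1 / 2)), 0; 0, -C (algebraMap ℂ R (1 / 2))] := by
  ext1 i j
  fin_cases i <;> fin_cases j <;> simp [sigmaSeries, halfSigma3]

theorem b_eq (n : ℕ+) : b n = (lam (n : ℤ) : LaurentSeries R) • toLaurent (sigmaSeries R) := by
  rw [b, toLaurent, sigmaSeries, Matrix.map_map]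
  congr 2
  ext1 x
  exact (HahnSeries.ofPowerSeries_C x).symm

theorem mapCoeff_toLaurent (D : R →ₗ[ℂ] R) (A : Matrix (Fin 2) (Fin 2) (PowerSeries R)) :
    mapCoeff D (toLaurent A) = toLaurent (A.map (mapDeriv D)) := by
  ext i j m
  simp only [mapCoeff, toLaurent, Matrix.map_apply, HahnSeries.map_coeff]
  rcases lt_or_ge m 0 with hm | hm
  · rw [coeff_ofPowerSeries_neg _ hm, coeff_ofPowerSeries_neg _ hm, map_zero]
  · lift m to ℕ using hm
    rw [coeff_ofPowerSeries_natCast, coeff_ofPowerSeries_natCast, mapDeriv, coeff_mk]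

/-! ### The hierarchy in terms of power series -/

section Dressing

variable {d : ℕ+ → Derivation ℂ R R} {q r : R} {Θ : Matrix (Fin 2) (Fin 2) (PowerSeries R)}

theorem IsDressing.conj_b (hΘ : IsDressing d q r Θ) (n : ℕ+) :
    toLaurent Θ * b n * (toLaurent Θ)⁻¹
      = (lam (n : ℤ) : LaurentSeries R) • toLaurent (Θ * sigmaSeries R * Θ⁻¹) := by
  rw [toLaurent_inv hΘ.det_eq_one, b_eq, toLaurent_mul, toLaurent_mul, Matrix.mul_smul,
    Matrix.smul_mul]

/-- The flow `∂_n Θ = (Θ b_n Θ⁻¹)_- Θ` as an identity of power series in `λ⁻¹`. -/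
theorem IsDressing.flow_eq (hΘ : IsDressing d q r Θ) (n : ℕ+) :
    Θ.map (mapDeriv (d n : R →ₗ[ℂ] R))
      = (Θ * sigmaSeries R * Θ⁻¹).map (negPart n) * Θ := by
  apply toLaurent_injective (R := R)
  rw [← mapCoeff_toLaurent, hΘ.flow, hΘ.conj_b, toLaurent_mul (_ : Matrix _ _ _) Θ]
  exact congrArg (· * toLaurent Θ) (minusPart_lam_smul (n : ℕ) (Θ * sigmaSeries R * Θ⁻¹))

theorem IsDressing.J_eq (hΘ : IsDressing d q r Θ) (n : ℕ+) :
    J Θ n = coeff n ((Θ.map fun f => -(X * d⁄dX R f)) * sigmaSeries R * Θ⁻¹).trace := by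
  rw [← gradedTrace_lam_smul, J, grade_toLaurent, toLaurent_inv hΘ.det_eq_one, b_eq,
    toLaurent_mul, toLaurent_mul, Matrix.mul_smul, Matrix.smul_mul]

theorem IsDressing.H_eq (hΘ : IsDressing d q r Θ) (n : ℕ+) :
    H Θ n = -coeff ((n : ℕ) + 1) (sigmaTrace Θ) := by
  have h : (lam ((1 : ℕ+) : ℤ) : LaurentSeries R) * lam (n : ℤ) = lam (((n : ℕ) + 1 : ℕ) : ℤ) := by
    simp [lam]
  rw [H, sigmaTrace, ← gradedTrace_lam_smul, ← h, toLaurent_inv hΘ.det_eq_one, b_eq, b_eq,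
    toLaurent_mul, toLaurent_mul, toLaurent_mul]
  simp only [Matrix.mul_smul, Matrix.smul_mul, smul_smul, mul_comm]
  rfl

end Dressing

end Laurent

section Flow

variable {R : Type*} [CommRing R] [Algebra ℂ R]

/-! ### The generating derivation of the flows -/

/-- `∑_{k ≥ 1} z^k D_k`, where the series written `D k` here is `D_{k+1}`. It is defined through its
coefficients, which are finite sums. -/
noncomputable def timeSum {R : Type*} [CommRing R] (D : ℕ → PowerSeries R) : PowerSeries R :=
  X * PowerSeries.mk fun n => ∑ p ∈ antidiagonal n, coeff p.2 (D p.1)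

theorem coeff_zero_timeSum {R : Type*} [CommRing R] (D : ℕ → PowerSeries R) :
    coeff 0 (timeSum D) = 0 := by
  simp [timeSum]

theorem coeff_succ_timeSum {R : Type*} [CommRing R] (D : ℕ → PowerSeries R) (n : ℕ) :
    coeff (n + 1) (timeSum D) = ∑ p ∈ antidiagonal n, coeff p.2 (D p.1) := by
  rw [timeSum, coeff_succ_X_mul, coeff_mk]

theorem timeSum_add {R : Type*} [CommRing R] (D D' : ℕ → PowerSeries R) :
    timeSum (fun k => D k + D' k) = timeSum D + timeSum D' := by
  ext n
  rcases n with _ | n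
  · rw [map_add, coeff_zero_timeSum, coeff_zero_timeSum, coeff_zero_timeSum, add_zero]
  · rw [map_add, coeff_succ_timeSum, coeff_succ_timeSum, coeff_succ_timeSum,
      ← Finset.sum_add_distrib]
    simp only [map_add]

theorem timeSum_mul {R : Type*} [CommRing R] (D : ℕ → PowerSeries R) (g : PowerSeries R) :
    timeSum (fun k => D k * g) = timeSum D * g := by
  rw [timeSum, timeSum, mul_assoc]
  congr 1
  ext n
  simp only [coeff_mk, coeff_mul, Finset.sum_mul]
  exact (sum_antidiagonal_assoc (fun i j k => coeff j (D i) * coeff k g) n).symm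

/-- `∑_{n ≥ 1} zⁿ (λⁿ f)_-`, at a single value of `λ = z⁻¹`: the coefficient of `z^k` is counted
once for each `1 ≤ n < k`. -/
theorem timeSum_negPart {R : Type*} [CommRing R] (f : PowerSeries R) :
    timeSum (fun k => negPart (k + 1) f) = X * d⁄dX R f - f + C (coeff 0 f) := by
  ext n
  rcases n with _ | n
  · rw [coeff_zero_timeSum]
    simp
  · have h (p : ℕ × ℕ) (hp : p ∈ antidiagonal n) : coeff p.2 (negPart (p.1 + 1) f)
        = coeff (n + 1) f - if p = (n, 0) then coeff (n + 1) f else 0 := by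
      have hp' := mem_antidiagonal.1 hp
      rw [negPart, coeff_mk, ← add_assoc, add_comm p.2, hp']
      rcases eq_or_ne p.2 0 with h0 | h0
      · rw [if_pos h0, if_pos (Prod.ext (by simpa [h0] using hp') h0), sub_self]
      · rw [if_neg h0, if_neg (fun h => h0 (congrArg Prod.snd h)), sub_zero]
    rw [coeff_succ_timeSum, Finset.sum_congr rfl h, Finset.sum_sub_distrib, Finset.sum_const,
      Finset.sum_ite_eq', if_pos (by simp), Finset.Nat.card_antidiagonal, map_add, map_sub,
      coeff_succ_X_mul, coeff_derivative, coeff_C, if_neg n.succ_ne_zero, nsmul_eq_mul]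
    push_cast
    ring

/-- `∑_{k ≥ 1} z^k ∂_k` acting on power series. -/
noncomputable def timeDeriv (d : ℕ+ → Derivation ℂ R R) (F : PowerSeries R) : PowerSeries R :=
  timeSum fun k => mapDeriv (d k.succPNat : R →ₗ[ℂ] R) F

variable (d : ℕ+ → Derivation ℂ R R)

theorem mapDeriv_X_mul (D : R →ₗ[ℂ] R) (F : PowerSeries R) :
    mapDeriv D (X * F) = mapDeriv D F * X := by
  rw [mul_comm _ X]
  ext n
  rcases n with _ | n
  · simp [mapDeriv]
  · rw [coeff_succ_X_mul, mapDeriv, mapDeriv, coeff_mk, coeff_mk, coeff_succ_X_mul]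

theorem mapDeriv_C_mul (D : Derivation ℂ R R) (t : R) (F : PowerSeries R) :
    mapDeriv (D : R →ₗ[ℂ] R) (C t * F)
      = C (D t) * F + mapDeriv (D : R →ₗ[ℂ] R) F * C t := by
  ext n
  simp [mapDeriv, coeff_C_mul, coeff_mul_C]
  ring

theorem timeDeriv_X_mul (F : PowerSeries R) : timeDeriv d (X * F) = X * timeDeriv d F := by
  simp only [timeDeriv, mapDeriv_X_mul, timeSum_mul]
  rw [mul_comm]

theorem timeDeriv_C_mul (t : R) (F : PowerSeries R) :
    timeDeriv d (C t * F)
      = timeSum (fun k => C (d k.succPNat t)) * F + C t * timeDeriv d F := by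
  simp only [timeDeriv, mapDeriv_C_mul, timeSum_add, timeSum_mul]
  rw [mul_comm (C t)]

/-- Solutions of `z dF/dz = ε ∑_{k ≥ 1} z^k ∂_k F` are shifts of their value at `z = 0`. -/
theorem eq_shift_of_timeDeriv (hd : ∀ m n f, d m (d n f) = d n (d m f)) {ε : ℂ}
    {F : PowerSeries R} (hF : X * d⁄dX R F = ε • timeDeriv d F) :
    F = shift d hd ε (coeff 0 F) := by
  refine eq_shift_of_isExpSeq d hd fun n => ?_
  have h := congrArg (coeff (n + 1)) hF
  rw [coeff_succ_X_mul, coeff_derivative, PowerSeries.coeff_smul, timeDeriv, coeff_succ_timeSum,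
    Finset.smul_sum] at h
  simp only [mapDeriv, coeff_mk] at h
  rw [add_smul, one_smul, Nat.cast_smul_eq_nsmul, nsmul_eq_mul]
  refine Eq.trans ?_ h
  ring

/-! ### The entries of the dressing matrix -/

section Dressing

variable {d} {q r : R} {Θ : Matrix (Fin 2) (Fin 2) (PowerSeries R)}

theorem C_half : C (algebraMap ℂ R (1 / 2)) + C (algebraMap ℂ R (1 / 2)) = (1 : PowerSeries R) := by
  rw [← map_add, ← map_add]
  norm_num

theorem IsDressing.det_eq (hΘ : IsDressing d q r Θ) : Θ 0 0 * Θ 1 1 - Θ 0 1 * Θ 1 0 = 1 := by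
  rw [← Matrix.det_fin_two, hΘ.det_eq_one]

/-- The entries of `Θ (½ σ₃) Θ⁻¹` for `det Θ = 1`. -/
theorem IsDressing.conj_sigma (hΘ : IsDressing d q r Θ) :
    Θ * sigmaSeries R * Θ⁻¹
      = !![Θ 0 0 * Θ 1 1 - C (algebraMap ℂ R (1 / 2)), -(Θ 0 0 * Θ 0 1);
          Θ 1 0 * Θ 1 1, C (algebraMap ℂ R (1 / 2)) - Θ 0 0 * Θ 1 1] := by
  have h := C_half (R := R)
  have hdet := hΘ.det_eq
  rw [inv_eq_of_det_eq_one hΘ.det_eq_one]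
  set s := C (algebraMap ℂ R (1 / 2))
  have hσ : sigmaSeries R = !![s, 0; 0, -s] := sigmaSeries_eq
  rw [hσ]
  ext1 i j
  fin_cases i <;> fin_cases j <;> simp [Matrix.mul_apply, Fin.sum_univ_two]
  · linear_combination (Θ 0 0 * Θ 1 1) * h - s * hdet
  · linear_combination (-Θ 0 0 * Θ 0 1) * h
  · linear_combination (Θ 1 0 * Θ 1 1) * h
  · linear_combination (-Θ 0 0 * Θ 1 1) * h + s * hdet

/-- The generating series `∑ₙ 𝒥ₙ λ⁻ⁿ` of the `𝒥ₙ`, in the form it takes when `det Θ = 1`. -/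
noncomputable def jSeries (Θ : Matrix (Fin 2) (Fin 2) (PowerSeries R)) : PowerSeries R :=
  X * (Θ 0 0 * d⁄dX R (Θ 1 1) - Θ 1 0 * d⁄dX R (Θ 0 1))

theorem IsDressing.deriv_det_eq (hΘ : IsDressing d q r Θ) :
    d⁄dX R (Θ 0 0) * Θ 1 1 + Θ 0 0 * d⁄dX R (Θ 1 1)
      - d⁄dX R (Θ 0 1) * Θ 1 0 - Θ 0 1 * d⁄dX R (Θ 1 0) = 0 := by
  have h := congrArg (d⁄dX R) hΘ.det_eq
  rw [map_sub, Derivation.leibniz, Derivation.leibniz, Derivation.map_one_eq_zero] at h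
  simp only [smul_eq_mul] at h
  linear_combination h

/-- The trace defining `𝒥ₙ` is brought to the form `jSeries` by the derivative of `det Θ = 1`. -/
theorem IsDressing.J_eq_coeff (hΘ : IsDressing d q r Θ) (n : ℕ+) :
    J Θ n = coeff n (jSeries Θ) := by
  have h := C_half (R := R)
  have hdet := hΘ.deriv_det_eq
  rw [hΘ.J_eq, inv_eq_of_det_eq_one hΘ.det_eq_one, jSeries]
  congr 1
  set s := C (algebraMap ℂ R (1 / 2))
  have hσ : sigmaSeries R = !![s, 0; 0, -s] := sigmaSeries_eq
  rw [hσ, Matrix.trace_fin_two]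
  simp [Matrix.mul_apply, Fin.sum_univ_two]
  linear_combination X * (Θ 0 0 * d⁄dX R (Θ 1 1) - Θ 1 0 * d⁄dX R (Θ 0 1)) * h - s * X * hdet

/-- The sum of the flows, `∑_{n ≥ 1} zⁿ ∂_n Θ = (z dM/dz - M + M(0)) Θ` with
`M = Θ (½ σ₃) Θ⁻¹`, entry by entry. -/
theorem IsDressing.timeDeriv_eq (hΘ : IsDressing d q r Θ) (i j : Fin 2) :
    timeDeriv d (Θ i j)
      = ∑ k, (X * d⁄dX R ((Θ * sigmaSeries R * Θ⁻¹) i k) - (Θ * sigmaSeries R * Θ⁻¹) i k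
          + C (coeff 0 ((Θ * sigmaSeries R * Θ⁻¹) i k))) * Θ k j := by
  have h (k : ℕ) : mapDeriv (d k.succPNat : R →ₗ[ℂ] R) (Θ i j)
      = negPart (k + 1) ((Θ * sigmaSeries R * Θ⁻¹) i 0) * Θ 0 j
        + negPart (k + 1) ((Θ * sigmaSeries R * Θ⁻¹) i 1) * Θ 1 j := by
    have h1 := congrFun (congrFun (hΘ.flow_eq k.succPNat) i) j
    rw [Matrix.mul_apply, Fin.sum_univ_two] at h1
    exact h1
  simp only [timeDeriv, h, timeSum_add, timeSum_mul, timeSum_negPart, Fin.sum_univ_two]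

theorem IsDressing.coeff_zero (hΘ : IsDressing d q r Θ) :
    coeff 0 (Θ 0 0) = 1 ∧ coeff 0 (Θ 0 1) = 0 ∧ coeff 0 (Θ 1 0) = 0 ∧ coeff 0 (Θ 1 1) = 1 := by
  simp [hΘ.constantCoeff_apply]

/-- With `M = Θ (½ σ₃) Θ⁻¹`, the columns of `Θ` are eigenvectors of `M`, and this turns
`∑_{n ≥ 1} zⁿ ∂_n Θ = (z dM/dz - M + M(0)) Θ` into a linear differential equation in `z` for each
entry. -/
theorem IsDressing.timeDeriv_entries (hΘ : IsDressing d q r Θ) :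
    timeDeriv d (Θ 0 0) = X * d⁄dX R (Θ 0 0) + jSeries Θ * Θ 0 0 ∧
    timeDeriv d (Θ 0 1) = -(X * d⁄dX R (Θ 0 1)) + jSeries Θ * Θ 0 1 + Θ 0 1 ∧
    timeDeriv d (Θ 1 0) = X * d⁄dX R (Θ 1 0) + jSeries Θ * Θ 1 0 - Θ 1 0 ∧
    timeDeriv d (Θ 1 1) = -(X * d⁄dX R (Θ 1 1)) + jSeries Θ * Θ 1 1 := by
  obtain ⟨h00, h01, h10, h11⟩ := hΘ.coeff_zero
  have hs := C_half (R := R)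
  have hdet := hΘ.det_eq
  have hdet' := hΘ.deriv_det_eq
  have h2 : (1 : R) - algebraMap ℂ R (1 / 2) = algebraMap ℂ R (1 / 2) := by
    rw [sub_eq_iff_eq_add, ← map_add]
    norm_num
  have c00 : coeff 0 (Θ 0 0 * Θ 1 1 - C (algebraMap ℂ R (1 / 2))) = algebraMap ℂ R (1 / 2) := by
    rw [map_sub, coeff_mul, coeff_zero_C]
    simp only [Finset.Nat.antidiagonal_zero, Finset.sum_singleton, h00, h11, mul_one, h2]
  have c11 : coeff 0 (C (algebraMap ℂ R (1 / 2)) - Θ 0 0 * Θ 1 1) = -algebraMap ℂ R (1 / 2) := by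
    rw [← neg_sub, map_neg, c00]
  have c01 : coeff 0 (-(Θ 0 0 * Θ 0 1)) = 0 := by
    simp only [map_neg, coeff_mul, Finset.Nat.antidiagonal_zero, Finset.sum_singleton, h01,
      mul_zero, neg_zero]
  have c10 : coeff 0 (Θ 1 0 * Θ 1 1) = 0 := by
    simp only [coeff_mul, Finset.Nat.antidiagonal_zero, Finset.sum_singleton, h10, zero_mul]
  refine ⟨?_, ?_, ?_, ?_⟩ <;>
    rw [hΘ.timeDeriv_eq, hΘ.conj_sigma, Fin.sum_univ_two] <;>
    simp only [Matrix.of_apply, Matrix.cons_val_zero, Matrix.cons_val_one, Matrix.cons_val',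
      Matrix.cons_val_fin_one, c00, c01, c10, c11, map_sub, map_neg, Derivation.leibniz,
      smul_eq_mul, derivative_C, map_zero, jSeries]
  · linear_combination (X * d⁄dX R (Θ 0 0) - Θ 0 0) * hdet + Θ 0 0 * hs
  · linear_combination (-X * d⁄dX R (Θ 0 1)) * hdet + Θ 0 1 * hs
  · linear_combination (X * d⁄dX R (Θ 1 0)) * hdet - X * Θ 1 0 * hdet' - Θ 1 0 * hs
  · linear_combination (-X * d⁄dX R (Θ 1 1) + Θ 1 1) * hdet - X * Θ 1 1 * hdet' - Θ 1 1 * hs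

/-- The coefficient of `λ⁰` in the dressing equation expresses the potential through the leading
off-diagonal coefficients of `Θ`. -/
theorem IsDressing.coeff_one (hΘ : IsDressing d q r Θ) :
    coeff 1 (Θ 0 1) = -q ∧ coeff 1 (Θ 1 0) = r := by
  obtain ⟨h00, h01, h10, h11⟩ := hΘ.coeff_zero
  have h2 : algebraMap ℂ R (1 / 2) + algebraMap ℂ R (1 / 2) = 1 := by
    rw [← map_add]
    norm_num
  set s := algebraMap ℂ R (1 / 2) with hs
  have hb : (b 1 : Matrix (Fin 2) (Fin 2) (LaurentSeries R))
      = !![lam (1 : ℕ) * HahnSeries.C s, 0; 0, -(lam (1 : ℕ) * HahnSeries.C s)] := by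
    ext1 i j
    fin_cases i <;> fin_cases j <;> simp [b, halfSigma3, hs]
  have hlax := hΘ.lax
  rw [mapCoeff_toLaurent, hb, potential] at hlax
  have hcoeff (i j : Fin 2) := congrArg (fun M => (M i j).coeff ((0 : ℕ) : ℤ)) hlax
  have hlam (f : PowerSeries R) :
      (lam ((1 : ℕ) : ℤ) * (HahnSeries.C s * HahnSeries.ofPowerSeries ℤ R f)).coeff ((0 : ℕ) : ℤ)
        = s * coeff 1 f := by
    rw [coeff_lam_mul, ← Nat.cast_add, zero_add, ← HahnSeries.ofPowerSeries_C, ← map_mul,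
      coeff_ofPowerSeries_natCast, coeff_C_mul]
  have hC (x : R) (f : PowerSeries R) :
      (HahnSeries.C x * HahnSeries.ofPowerSeries ℤ R f).coeff ((0 : ℕ) : ℤ) = x * coeff 0 f := by
    rw [← HahnSeries.ofPowerSeries_C, ← map_mul, coeff_ofPowerSeries_natCast, coeff_C_mul]
  have g01 := hcoeff 0 1
  have g10 := hcoeff 1 0
  simp only [toLaurent, Matrix.map_apply, Matrix.mul_apply,
    Fin.sum_univ_two, Matrix.sub_apply, Matrix.add_apply, Matrix.of_apply, Matrix.cons_val_zero,
    Matrix.cons_val_one, Matrix.cons_val', Matrix.cons_val_fin_one, coeff_ofPowerSeries_natCast,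
    mapDeriv, coeff_mk] at g01 g10
  constructor
  · rw [h01, LinearMap.map_zero, mul_zero, zero_add, add_zero, zero_add, mul_neg,
      mul_comm (HahnSeries.ofPowerSeries ℤ R _), mul_assoc, HahnSeries.coeff_sub,
      HahnSeries.coeff_neg, HahnSeries.coeff_add, hlam, hC, h11] at g01
    linear_combination g01 - coeff 1 (Θ 0 1) * h2
  · rw [h10, LinearMap.map_zero, mul_zero, add_zero, add_zero, zero_add, neg_mul,
      mul_comm (HahnSeries.ofPowerSeries ℤ R _), mul_assoc, HahnSeries.coeff_sub,
      HahnSeries.coeff_add, HahnSeries.coeff_neg, hlam, hC, h00] at g10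
    linear_combination -g10 - coeff 1 (Θ 1 0) * h2

end Dressing

end Flow

section TauFunction

variable {R : Type*} [CommRing R]

/-! ### The tau-function -/

theorem X_mul_left_cancel {f g : PowerSeries R} (h : X * f = X * g) : f = g := by
  ext n
  rw [← coeff_succ_X_mul n f, h, coeff_succ_X_mul]

theorem C_inv_mul_C (τ : Rˣ) : C (↑τ⁻¹ : R) * C (τ : R) = (1 : PowerSeries R) := by
  rw [← map_mul, Units.inv_mul, map_one]

theorem coeff_one_negPart_mul (n : ℕ) (f g : PowerSeries R) :
    coeff 1 (negPart n f * g) = coeff (n + 1) f * coeff 0 g := by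
  simp [coeff_mul, Finset.Nat.antidiagonal_succ, negPart, add_comm]

variable [Algebra ℂ R]

section Tau

variable {d : ℕ+ → Derivation ℂ R R} {q r : R} {Θ : Matrix (Fin 2) (Fin 2) (PowerSeries R)}
  {τ : Rˣ}

/-- `∑_{n ≥ 1} zⁿ ∂_n τ = -τ ∑ₙ 𝒥ₙ zⁿ`. -/
theorem timeSum_C_tau (hΘ : IsDressing d q r Θ) (hτ : IsTau d Θ τ) :
    timeSum (fun k => C (d k.succPNat (τ : R))) = -(C (τ : R) * jSeries Θ) := by
  ext n
  rcases n with _ | n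
  · rw [coeff_zero_timeSum]
    simp [jSeries]
  · have h : coeff (n + 1) (jSeries Θ) = -dlog d n.succPNat τ :=
      (hΘ.J_eq_coeff n.succPNat).symm.trans (hτ n.succPNat)
    rw [coeff_succ_timeSum, Finset.Nat.sum_antidiagonal_eq_sum_range_succ
      (fun i j => coeff j (C (d i.succPNat (τ : R)))), map_neg, coeff_C_mul, h, dlog, mul_neg,
      neg_neg, Units.mul_inv_cancel_left, Finset.sum_range_succ, Finset.sum_eq_zero, zero_add,
      Nat.sub_self, coeff_zero_C]
    intro i hi
    rw [coeff_C, if_neg (by have := Finset.mem_range.1 hi; omega)]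

/-- Multiplication by `τ` removes the term `(∑ₙ 𝒥ₙ zⁿ) F` from the equations of the entries of `Θ`,
since `∂_n log τ = -𝒥ₙ`. -/
theorem timeDeriv_tau_mul (hΘ : IsDressing d q r Θ) (hτ : IsTau d Θ τ) (F : PowerSeries R) :
    timeDeriv d (C (τ : R) * F) = C (τ : R) * (timeDeriv d F - jSeries Θ * F) := by
  rw [timeDeriv_C_mul, timeSum_C_tau hΘ hτ]
  ring

variable (hd : ∀ m n f, d m (d n f) = d n (d m f))

theorem tau_mul_diag (hΘ : IsDressing d q r Θ) (hτ : IsTau d Θ τ) :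
    C (τ : R) * Θ 0 0 = shift d hd 1 τ ∧ C (τ : R) * Θ 1 1 = shift d hd (-1) τ := by
  obtain ⟨h00, -, -, h11⟩ := hΘ.coeff_zero
  obtain ⟨e00, -, -, e11⟩ := hΘ.timeDeriv_entries
  constructor
  · have h := eq_shift_of_timeDeriv d hd (ε := 1) (F := C (τ : R) * Θ 0 0) (by
      rw [timeDeriv_tau_mul hΘ hτ, e00, Derivation.leibniz, derivative_C, one_smul]
      simp only [smul_eq_mul]
      ring)
    rwa [coeff_C_mul, h00, mul_one] at h
  · have h := eq_shift_of_timeDeriv d hd (ε := -1) (F := C (τ : R) * Θ 1 1) (by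
      rw [timeDeriv_tau_mul hΘ hτ, e11, Derivation.leibniz, derivative_C, neg_one_smul]
      simp only [smul_eq_mul]
      ring)
    rwa [coeff_C_mul, h11, mul_one] at h

/-- The off-diagonal entries of `τ Θ` are divisible by `z`, and their quotients by `z` solve the
equation of a shift with the initial values `-q τ` and `r τ`. -/
theorem tau_mul_offDiag (hΘ : IsDressing d q r Θ) (hτ : IsTau d Θ τ) :
    C (τ : R) * Θ 0 1 = -(X * shift d hd (-1) q * shift d hd (-1) τ) ∧
      C (τ : R) * Θ 1 0 = X * shift d hd 1 r * shift d hd 1 τ := by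
  obtain ⟨-, h01, h10, -⟩ := hΘ.coeff_zero
  obtain ⟨-, e01, e10, -⟩ := hΘ.timeDeriv_entries
  obtain ⟨c01, c10⟩ := hΘ.coeff_one
  rw [coeff_zero_eq_constantCoeff_apply, ← X_dvd_iff] at h01 h10
  obtain ⟨f, hf⟩ := h01
  obtain ⟨g, hg⟩ := h10
  constructor
  · have h := eq_shift_of_timeDeriv d hd (ε := -1) (F := C (τ : R) * f) (by
      apply X_mul_left_cancel
      rw [mul_smul_comm, ← timeDeriv_X_mul, mul_left_comm X (C _) f, ← hf,
        timeDeriv_tau_mul hΘ hτ, e01, hf, Derivation.leibniz, Derivation.leibniz, derivative_C,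
        derivative_X, neg_one_smul]
      simp only [smul_eq_mul]
      ring)
    have hf0 : coeff 0 f = -q := by rw [← c01, hf, coeff_succ_X_mul]
    have hneg : shift d hd (-1) (-(q * τ)) = -(shift d hd (-1) q * shift d hd (-1) τ) := by
      rw [← shift_mul]
      ext n
      simp [shift]
    rw [coeff_C_mul, hf0, show (τ : R) * -q = -(q * τ) by ring, hneg] at h
    rw [hf]
    linear_combination X * h
  · have h := eq_shift_of_timeDeriv d hd (ε := 1) (F := C (τ : R) * g) (by
      apply X_mul_left_cancel
      rw [mul_smul_comm, ← timeDeriv_X_mul, mul_left_comm X (C _) g, ← hg,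
        timeDeriv_tau_mul hΘ hτ, e10, hg, Derivation.leibniz, Derivation.leibniz, derivative_C,
        derivative_X, one_smul]
      simp only [smul_eq_mul]
      ring)
    have hg0 : coeff 0 g = r := by rw [← c10, hg, coeff_succ_X_mul]
    rw [coeff_C_mul, hg0, mul_comm, shift_mul] at h
    rw [hg]
    linear_combination X * h

/-- `tr (½ σ₃ Θ ½ σ₃ Θ⁻¹)` is the upper diagonal entry of `Θ (½ σ₃) Θ⁻¹`, as that matrix is
traceless. -/
theorem IsDressing.sigmaTrace_eq (hΘ : IsDressing d q r Θ) :
    sigmaTrace Θ = Θ 0 0 * Θ 1 1 - C (algebraMap ℂ R (1 / 2)) := by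
  have h := C_half (R := R)
  have h1 : sigmaTrace Θ = (sigmaSeries R * (Θ * sigmaSeries R * Θ⁻¹)).trace := by
    simp only [sigmaTrace, sigmaSeries, Matrix.mul_assoc]
  rw [h1, hΘ.conj_sigma]
  set s := C (algebraMap ℂ R (1 / 2))
  have hσ : sigmaSeries R = !![s, 0; 0, -s] := sigmaSeries_eq
  rw [hσ, Matrix.trace_fin_two]
  simp [Matrix.mul_apply, Fin.sum_univ_two]
  linear_combination (Θ 0 0 * Θ 1 1 - s) * h

/-- The coefficient of `λ⁻¹` vanishes because `Θ₀₀ Θ₁₁ = 1 + Θ₀₁ Θ₁₀` and both off-diagonal entries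
are divisible by `λ⁻¹`. -/
theorem IsDressing.sigmaTrace_eq_genSeries (hΘ : IsDressing d q r Θ) :
    sigmaTrace Θ = -genSeries (H Θ) + C (algebraMap ℂ R (1 / 2)) := by
  obtain ⟨-, h01, h10, -⟩ := hΘ.coeff_zero
  have h : sigmaTrace Θ = Θ 0 1 * Θ 1 0 + C (algebraMap ℂ R (1 / 2)) := by
    rw [hΘ.sigmaTrace_eq]
    linear_combination hΘ.det_eq - C_half (R := R)
  ext m
  match m with
  | 0 =>
    rw [h]
    simp [genSeries, hΘ.constantCoeff_apply]
  | 1 =>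
    rw [h]
    simp [genSeries, coeff_mul, h01, h10, Finset.Nat.antidiagonal_succ]
  | m + 2 =>
    have h1 := hΘ.H_eq m.succPNat
    have h2 : coeff (m + 2) (genSeries (H Θ)) = H Θ m.succPNat := by
      simp [genSeries]
      rfl
    simp only [Nat.succPNat_coe] at h1
    rw [map_add, map_neg, h2, h1, coeff_C, if_neg (by omega)]
    simp

/-- `∂_n 𝒥₁ = ℋ_n`: here `𝒥₁` is the coefficient of `λ⁻¹` of the lower diagonal entry of `Θ`,
whose derivative the flow gives. -/
theorem IsDressing.H_eq_dlog (hΘ : IsDressing d q r Θ) (hτ : IsTau d Θ τ) (n : ℕ+) :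
    H Θ n = -d n (dlog d 1 τ) := by
  obtain ⟨h00, h01, h10, h11⟩ := hΘ.coeff_zero
  have hJ : dlog d 1 τ = -coeff 1 (Θ 1 1) := by
    rw [← neg_eq_iff_eq_neg, ← hτ 1, hΘ.J_eq_coeff, jSeries]
    refine (coeff_succ_X_mul 0 _).trans ?_
    rw [map_sub, coeff_mul, coeff_mul]
    simp only [Finset.Nat.antidiagonal_zero, Finset.sum_singleton, h00, h10, coeff_derivative]
    simp
  have h1 := congrArg (coeff 1) (congrFun (congrFun (hΘ.flow_eq n) 1) 1)
  have h2 : sigmaTrace Θ = -(Θ * sigmaSeries R * Θ⁻¹) 1 1 := by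
    rw [hΘ.sigmaTrace_eq, hΘ.conj_sigma]
    simp
  rw [Matrix.mul_apply, Fin.sum_univ_two, map_add] at h1
  simp only [Matrix.map_apply, coeff_one_negPart_mul, h01, h11, mul_zero, mul_one, zero_add,
    mapDeriv, coeff_mk] at h1
  rw [hJ, map_neg, neg_neg, hΘ.H_eq, h2, map_neg, neg_neg]
  exact h1.symm

theorem tauRatio_eq (hΘ : IsDressing d q r Θ) (hτ : IsTau d Θ τ) :
    tauRatio d hd τ = Θ 0 0 * Θ 1 1 := by
  obtain ⟨h0, h1⟩ := tau_mul_diag hd hΘ hτ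
  rw [tauRatio, ← h0, ← h1, map_pow]
  linear_combination (Θ 0 0 * Θ 1 1) * (C (↑τ⁻¹ : R) * C (τ : R) + 1) * C_inv_mul_C τ

end Tau

end TauFunction

end AKNS

theorem mainTheorem9 {R : Type*} [CommRing R] [Algebra ℂ R]
    (d : ℕ+ → Derivation ℂ R R) (hd : ∀ m n f, d m (d n f) = d n (d m f))
    (q r : R) (Θ : Matrix (Fin 2) (Fin 2) (PowerSeries R)) (hΘ : AKNS.IsDressing d q r Θ)
    (τ : Rˣ) (hτ : AKNS.IsTau d Θ τ) :
    Θ = PowerSeries.C (↑τ⁻¹ : R) •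
        !![AKNS.shift d hd 1 τ,
            -(PowerSeries.X * AKNS.shift d hd (-1) q * AKNS.shift d hd (-1) τ);
          PowerSeries.X * AKNS.shift d hd 1 r * AKNS.shift d hd 1 τ,
            AKNS.shift d hd (-1) τ] ∧
    Θ⁻¹ = PowerSeries.C (↑τ⁻¹ : R) •
        !![AKNS.shift d hd (-1) τ,
            PowerSeries.X * AKNS.shift d hd (-1) q * AKNS.shift d hd (-1) τ;
          -(PowerSeries.X * AKNS.shift d hd 1 r * AKNS.shift d hd 1 τ),
            AKNS.shift d hd 1 τ] ∧
    Θ.det = 1 ∧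
    1 = AKNS.tauRatio d hd τ *
        (1 + PowerSeries.X ^ 2 * AKNS.shift d hd (-1) q * AKNS.shift d hd 1 r) ∧
    AKNS.sigmaTrace Θ
      = AKNS.tauRatio d hd τ - PowerSeries.C (algebraMap ℂ R (1 / 2)) ∧
    AKNS.sigmaTrace Θ
      = -AKNS.genSeries (AKNS.H Θ) + PowerSeries.C (algebraMap ℂ R (1 / 2)) ∧
    (∀ n : ℕ+, AKNS.H Θ n = -d n (AKNS.dlog d 1 τ)) ∧
    AKNS.HirotaGenerating d hd τ ∧
    AKNS.HirotaBilinear d hd τ ∧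
    (∀ ρ : Rˣ, AKNS.HirotaGenerating d hd ρ ↔ AKNS.HirotaBilinear d hd ρ) := by
  obtain ⟨h00, h11⟩ := AKNS.tau_mul_diag hd hΘ hτ
  obtain ⟨h01, h10⟩ := AKNS.tau_mul_offDiag hd hΘ hτ
  have hinv := AKNS.C_inv_mul_C τ
  have hratio := AKNS.tauRatio_eq hd hΘ hτ
  have hgen : AKNS.HirotaGenerating d hd τ := by
    have h1 := hΘ.sigmaTrace_eq
    have h2 : AKNS.genSeries (AKNS.H Θ)
        = -AKNS.genSeries (fun n => d n (AKNS.dlog d 1 τ)) := by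
      ext m
      simp only [AKNS.genSeries, PowerSeries.coeff_mk, map_neg]
      split_ifs
      · exact hΘ.H_eq_dlog hτ _
      · exact neg_zero.symm
    rw [hΘ.sigmaTrace_eq_genSeries, h2, ← hratio] at h1
    rw [AKNS.HirotaGenerating]
    linear_combination -h1 + AKNS.C_half (R := R)
  refine ⟨?_, ?_, hΘ.det_eq_one, ?_, ?_, hΘ.sigmaTrace_eq_genSeries, hΘ.H_eq_dlog hτ, hgen,
    (AKNS.hirotaGenerating_iff_hirotaBilinear d hd τ).1 hgen,
    AKNS.hirotaGenerating_iff_hirotaBilinear d hd⟩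
  · rw [← h01, ← h10, ← h00, ← h11]
    ext1 i j
    fin_cases i <;> fin_cases j <;> simp [← mul_assoc, hinv]
  · rw [AKNS.inv_eq_of_det_eq_one hΘ.det_eq_one, ← neg_eq_iff_eq_neg.2 h01, ← h10, ← h00, ← h11]
    ext1 i j
    fin_cases i <;> fin_cases j <;> simp [← mul_assoc, hinv]
  · have h : AKNS.tauRatio d hd τ *
          (1 + PowerSeries.X ^ 2 * AKNS.shift d hd (-1) q * AKNS.shift d hd 1 r)
        = PowerSeries.C (↑τ⁻¹ : R) ^ 2 * (AKNS.shift d hd 1 τ * AKNS.shift d hd (-1) τ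
          + (PowerSeries.X * AKNS.shift d hd (-1) q * AKNS.shift d hd (-1) τ)
            * (PowerSeries.X * AKNS.shift d hd 1 r * AKNS.shift d hd 1 τ)) := by
      rw [AKNS.tauRatio, map_pow]
      ring
    rw [h, ← neg_eq_iff_eq_neg.2 h01, ← h10, ← h00, ← h11]
    linear_combination -(PowerSeries.C (↑τ⁻¹ : R) * PowerSeries.C (τ : R) + 1)
      * (Θ 0 0 * Θ 1 1 - Θ 0 1 * Θ 1 0) * hinv - hΘ.det_eq
  · rw [hΘ.sigmaTrace_eq, hratio]
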